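/- Consider a multi-sender uniprior multicast index coding problem: there are finitely many receivers $r \in \mathcal{V}=\{1,\dots,n\}$, independent message bits $x_r\in\{0,1\}$, and finitely many senders $s\in\{1,\dots,S\}$. Receiver $r$ knows a priori exactly its own message $x_r$ and requires the set of messages $\{x_i : i \in \mathcal{W}_r\}$, $r\notin\mathcal{W}_r$; sender $s$ knows exactly the messages $\{x_i : i\in\mathcal{M}_s\}$, and every message is known to some sender. (Some labels $r$ whose message nobody requires may have no message at all; then receiver $r$ has no prior knowledge and $r$ lies in no $\mathcal{M}_s$.) An index code consists of encoding functions, by which sender $s$ maps the bits it knows to $\ell_s$ bits, and of decoding functions, by which each receiver recovers its required messages from all $S$ codewords and its prior knowledge, for all message values; its codelength is $\sum_s \ell_s$, and $\tilde\ell^*$ denotes the minimum codelength of an index code. Let $\mathcal{G}$ be the digraph on $\mathcal{V}$ with an arc $i\to j$ iff $i\in\mathcal{W}_j$, and $\mathcal{U}$ the undirected graph on $\mathcal{V}$ with an edge between $i\neq j$ iff $i,j\in\mathcal{M}_s$ for some $s$. Let $V_{\mathrm{out}}(\mathcal{G})$ be the number of vertices with at least one outgoing arc. A leaf SCC of $\mathcal{G}$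 is a strongly connected component with at least two vertices and no arc leaving it. It is message-connected if any two of its vertices are joined by a path in $\mathcal{U}$ inside the component, message-disconnected if some two of its vertices are joined by no path in $\mathcal{U}$, and semi-message-connected if it is neither. Let $c$ be the number of message-connected leaf SCCs. If each message is known to only one sender, i.e. the sets $\mathcal{M}_s$ partition the messages (empty sets $\mathcal{M}_s$ being allowed), then there is no semi-message-connected leaf SCC, and $$\tilde\ell^* = V_{\mathrm{out}}(\mathcal{G}) - c .$$ In particular, for a single sender ($S=1$) every leaf SCC is message-connected, and $\tilde\ell^*$ equals $V_{\mathrm{out}}(\mathcal{G})$ minus the number of all leaf SCCs of $\mathcal{G}$. -/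

import Mathlib

/-- A multi-sender index coding problem with binary messages. `S` indexes the senders, `R` the
receivers, `X` the messages. Sender `s` knows the messages in `M s`; receiver `r` knows the messages
in `K r` and requires those in `W r`. The messages of the problem are the elements of `⋃ s, M s`
(each message is available at some sender); elements of `X` outside this set play no role. -/
structure IndexCodingProblem (S R X : Type*) where
  M : S → Set X
  W : R → Set X
  K : R → Set X
  W_subset : ∀ r, W r ⊆ ⋃ s, M s
  K_subset : ∀ r, K r ⊆ ⋃ s, M s
  disjoint : ∀ r, Disjoint (W r) (K r)

namespace IndexCodingProblem

/-- The set of messages of the problem. -/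
def messages {S R X : Type*} (P : IndexCodingProblem S R X) : Set X := ⋃ s, P.M s

/-- A multi-sender index code: sender `s` encodes the bits that it knows into `len s` bits, all
codewords are given to all receivers, and receiver `r` decodes the bits that it requires from all
codewords together with the bits that it knows. -/
structure Code {S R X : Type*} (P : IndexCodingProblem S R X) where
  len : S → ℕ
  enc : (s : S) → (P.M s → Bool) → (Fin (len s) → Bool)
  dec : (r : R) → ((s : S) → Fin (len s) → Bool) → (P.K r → Bool) → (P.W r → Bool)
  correct : ∀ (x : X → Bool) (r : R),
    dec r (fun s => enc s (fun i : P.M s => x i)) (fun i : P.K r => x i) = fun i : P.W r => x i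

/-- The index codelength: the total number of transmitted bits. -/
def Code.length {S R X : Type*} [Fintype S] {P : IndexCodingProblem S R X} (c : P.Code) : ℕ :=
  ∑ s, c.len s

/-- `ℓ` is the optimal (minimum) index codelength. -/
def IsOptimalLength {S R X : Type*} [Fintype S] (P : IndexCodingProblem S R X) (ℓ : ℕ) : Prop :=
  IsLeast {l : ℕ | ∃ c : P.Code, c.length = l} ℓ

/-- Uniprior multicast: receivers and messages carry the same labels, and receiver `r` knows
exactly its own message `r`. If the label `r` has no message (`x_r = ∅`, which is what the
simplified model does with messages that nobody requires), then receiver `r` knows nothing. When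
`P.messages = Set.univ`, this says `P.K r = {r}` for every `r`. -/
def IsUnipriorMulticast {S V : Type*} (P : IndexCodingProblem S V V) : Prop :=
  ∀ r, P.K r = {r} ∩ P.messages

/-- The information-flow digraph: `i → j` iff receiver `j` requires `x_i`. -/
def infoFlow {S V : Type*} (P : IndexCodingProblem S V V) : Digraph V where
  Adj i j := i ∈ P.W j

/-- The message graph: `i` and `j` are adjacent iff `i ≠ j` and some sender knows both messages. -/
def messageGraph {S V : Type*} (P : IndexCodingProblem S V V) : SimpleGraph V where
  Adj i j := i ≠ j ∧ ∃ s, i ∈ P.M s ∧ j ∈ P.M s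
  symm := ⟨fun _ _ h => ⟨h.1.symm, h.2.imp fun _ hs => ⟨hs.2, hs.1⟩⟩⟩
  loopless := ⟨fun _ h => h.1 rfl⟩

end IndexCodingProblem

/-- The number of non-leaf vertices of a digraph, i.e. those with at least one outgoing arc. -/
noncomputable def Vout {V : Type*} (G : Digraph V) : ℕ := {i : V | ∃ j, G.Adj i j}.ncard

/-- Between any two vertices of `C` there is a directed path inside the subgraph induced on `C`. -/
def StronglyConnectedOn {V : Type*} (G : Digraph V) (C : Set V) : Prop :=
  ∀ i ∈ C, ∀ j ∈ C, Relation.ReflTransGen (fun a b => a ∈ C ∧ b ∈ C ∧ G.Adj a b) i j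

/-- `C` is the vertex set of a leaf SCC: a strongly connected component with at least two vertices
and without arcs that leave it. -/
structure IsLeafSCC {V : Type*} (G : Digraph V) (C : Set V) : Prop where
  maximal : Maximal (StronglyConnectedOn G) C
  nontrivial : C.Nontrivial
  no_outgoing : ∀ i ∈ C, ∀ j, G.Adj i j → j ∈ C

/-- Any two vertices of `C` are joined by a path of `U` that stays in `C`. -/
def MessageConnected {V : Type*} (U : SimpleGraph V) (C : Set V) : Prop :=
  (U.induce C).Preconnected

/-- Some two vertices of `C` are not joined by any path of `U`. -/
def MessageDisconnected {V : Type*} (U : SimpleGraph V) (C : Set V) : Prop :=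
  ∃ i ∈ C, ∃ j ∈ C, ¬ U.Reachable i j

/-- A semi-message-connected leaf SCC: neither message-connected nor message-disconnected. -/
def IsSemiLeafSCC {V : Type*} (G : Digraph V) (U : SimpleGraph V) (C : Set V) : Prop :=
  IsLeafSCC G C ∧ ¬ MessageConnected U C ∧ ¬ MessageDisconnected U C

/-- The number of leaf SCCs. -/
noncomputable def numLeafSCC {V : Type*} (G : Digraph V) : ℕ :=
  {C : Set V | IsLeafSCC G C}.ncard

/-- The number of message-connected leaf SCCs. -/
noncomputable def numMessageConnectedLeafSCC {V : Type*} (G : Digraph V) (U : SimpleGraph V) : ℕ :=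
  {C : Set V | IsLeafSCC G C ∧ MessageConnected U C}.ncard

/-! Lower bound: fix the codewords. If `i → j` and `x j` is known, receiver `j` decodes `x i`, so
knowledge travels backwards along arcs. Every vertex reaches a sink or a leaf SCC, so it suffices to
know the sink bits and one bit per leaf SCC. A leaf SCC not contained in one sender's set gives such
a bit for free: it has an arc `a → b` across two senders, and what `b` knows does not affect the
codeword carrying `x a` (`Code.eq_of_adj_of_notMem`). Hence only the message-connected leaf SCCs
cost an extra bit, and counting inputs gives the bound.

Upper bound: a message-connected leaf SCC lies in one sender's set, so that sender can add a root
bit to all its other bits there, saving one transmission (`exists_code_length_add`). -/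

/-! ### Leaf SCCs of a finite digraph -/

open Relation in
/-- Every vertex of a finite loopless digraph has a path to a vertex without outgoing arcs or to a
leaf SCC. -/
theorem Digraph.exists_reach_sink_or_leafSCC {V : Type*} [Finite V] (G : Digraph V)
    (hG : ∀ i, ¬ G.Adj i i) (i : V) :
    ∃ k, ReflTransGen G.Adj i k ∧ ((∀ j, ¬ G.Adj k j) ∨ ∃ C, IsLeafSCC G C ∧ k ∈ C) := by
  -- By minimality every vertex reachable from `k` has the same reachable set as `k`, hence leads
  -- back to `k`. That set is the leaf SCC unless `k` is a sink.
  obtain ⟨k, hik, hmin⟩ := Set.exists_min_image {k | ReflTransGen G.Adj i k}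
    (fun k => {l | ReflTransGen G.Adj k l}.ncard) (Set.toFinite _) ⟨i, .refl⟩
  have back : ∀ l, ReflTransGen G.Adj k l → ReflTransGen G.Adj l k := by
    intro l hkl
    have hsub : {m | ReflTransGen G.Adj l m} ⊆ {m | ReflTransGen G.Adj k m} :=
      fun m hm => hkl.trans hm
    have heq := Set.eq_of_subset_of_ncard_le hsub (hmin l (hik.trans hkl)) (Set.toFinite _)
    have hk : k ∈ {m | ReflTransGen G.Adj k m} := ReflTransGen.refl
    rw [← heq] at hk
    exact hk
  refine ⟨k, hik, ?_⟩
  by_cases hk : ∀ j, ¬ G.Adj k j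
  · exact .inl hk
  right
  push Not at hk
  obtain ⟨j, hj⟩ := hk
  have lift : ∀ a b, ReflTransGen G.Adj k a → ReflTransGen G.Adj a b →
      ReflTransGen (fun a b => a ∈ {l | ReflTransGen G.Adj k l} ∧
        b ∈ {l | ReflTransGen G.Adj k l} ∧ G.Adj a b) a b := by
    intro a b ha hab
    induction hab with
    | refl => exact .refl
    | tail hab hbc ih => exact ih.tail ⟨ha.trans hab, (ha.trans hab).tail hbc, hbc⟩
  refine ⟨{l | ReflTransGen G.Adj k l}, ⟨⟨fun a ha b hb => lift a b ha ((back a ha).trans hb), ?_⟩,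
    ⟨k, .refl, j, .single hj, fun h => hG k (by rw [← h] at hj; exact hj)⟩,
    fun a ha b hab => ReflTransGen.tail ha hab⟩, .refl⟩
  intro D hD hCD a ha
  exact ReflTransGen.mono (fun _ _ h => h.2.2) _ _ (hD k (hCD .refl) a ha)

theorem StronglyConnectedOn.union {V : Type*} {G : Digraph V} {C D : Set V}
    (hC : StronglyConnectedOn G C) (hD : StronglyConnectedOn G D) {k : V} (hkC : k ∈ C)
    (hkD : k ∈ D) : StronglyConnectedOn G (C ∪ D) := by
  have key : ∀ i ∈ C ∪ D, Relation.ReflTransGen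
      (fun a b => a ∈ C ∪ D ∧ b ∈ C ∪ D ∧ G.Adj a b) i k ∧ Relation.ReflTransGen
      (fun a b => a ∈ C ∪ D ∧ b ∈ C ∪ D ∧ G.Adj a b) k i := by
    rintro i (hi | hi)
    · exact ⟨Relation.ReflTransGen.mono (fun _ _ h => ⟨.inl h.1, .inl h.2.1, h.2.2⟩) _ _ (hC i hi k hkC),
        Relation.ReflTransGen.mono (fun _ _ h => ⟨.inl h.1, .inl h.2.1, h.2.2⟩) _ _ (hC k hkC i hi)⟩
    · exact ⟨Relation.ReflTransGen.mono (fun _ _ h => ⟨.inr h.1, .inr h.2.1, h.2.2⟩) _ _ (hD i hi k hkD),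
        Relation.ReflTransGen.mono (fun _ _ h => ⟨.inr h.1, .inr h.2.1, h.2.2⟩) _ _ (hD k hkD i hi)⟩
  exact fun i hi j hj => (key i hi).1.trans (key j hj).2

/-- Leaf SCCs that share a vertex coincide. -/
theorem IsLeafSCC.eq_of_mem {V : Type*} {G : Digraph V} {C D : Set V} (hC : IsLeafSCC G C)
    (hD : IsLeafSCC G D) {k : V} (hkC : k ∈ C) (hkD : k ∈ D) : C = D := by
  have hU := hC.maximal.1.union hD.maximal.1 hkC hkD
  exact (hC.maximal.eq_of_subset hU Set.subset_union_left).trans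
    (hD.maximal.eq_of_subset hU Set.subset_union_right).symm

theorem IsLeafSCC.exists_adj {V : Type*} {G : Digraph V} {C : Set V} (hC : IsLeafSCC G C)
    {i : V} (hi : i ∈ C) : ∃ j, G.Adj i j := by
  obtain ⟨j, hj, hne⟩ := hC.nontrivial.exists_ne i
  rcases (hC.maximal.1 i hi j hj).cases_head with h | ⟨k, hk, -⟩
  · exact absurd h.symm hne
  · exact ⟨k, hk.2.2⟩

/-- A nonempty vertex set that a strongly connected set meets but does not lie in is entered by an
arc inside the strongly connected set. -/
theorem StronglyConnectedOn.exists_crossing {V : Type*} {G : Digraph V} {C A : Set V}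
    (hC : StronglyConnectedOn G C) {i j : V} (hi : i ∈ C) (hiA : i ∈ A) (hj : j ∈ C)
    (hjA : j ∉ A) : ∃ a ∈ C, ∃ b ∈ C, G.Adj a b ∧ a ∉ A ∧ b ∈ A := by
  by_contra! h
  have : ∀ l, Relation.ReflTransGen (fun a b => a ∈ C ∧ b ∈ C ∧ G.Adj a b) j l → l ∉ A := by
    intro l hl
    induction hl with
    | refl => exact hjA
    | tail _ hbc ih => exact h _ hbc.1 _ hbc.2.1 hbc.2.2 ih
  exact this i (hC j hj i hi) hiA

/-! ### Codes and sender sets -/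

namespace IndexCodingProblem

/-- Encoders from which the required bits are determined extend to an index code. -/
theorem exists_code_of_determined {S R X : Type*} (P : IndexCodingProblem S R X) (len : S → ℕ)
    (enc : (s : S) → (P.M s → Bool) → (Fin (len s) → Bool))
    (h : ∀ (x y : X → Bool) (r : R),
      (∀ s, enc s (fun i : P.M s => x i) = enc s (fun i : P.M s => y i)) →
      (∀ i ∈ P.K r, x i = y i) → ∀ i ∈ P.W r, x i = y i) :
    ∃ c : P.Code, c.len = len := by
  classical
  -- The decoder picks any input consistent with what it sees; by `h` the choice does not affect
  -- required bits.
  refine ⟨⟨len, enc, fun r e k i =>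
    if hx : ∃ x : X → Bool, (fun s => enc s (fun i : P.M s => x i)) = e ∧
      (fun i : P.K r => x i) = k then hx.choose i else false, fun x r => ?_⟩, rfl⟩
  funext i
  have hx : ∃ z : X → Bool, (fun s => enc s (fun i : P.M s => z i)) =
      (fun s => enc s (fun i : P.M s => x i)) ∧
      (fun i : P.K r => z i) = (fun i : P.K r => x i) := ⟨x, rfl, rfl⟩
  rw [dif_pos hx]
  exact h _ x r (fun s => congrFun hx.choose_spec.1 s)
    (fun i hi => congrFun hx.choose_spec.2 ⟨i, hi⟩) i i.2

theorem Code.determined {S R X : Type*} {P : IndexCodingProblem S R X} (c : P.Code)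
    {x y : X → Bool} {r : R}
    (he : ∀ s, c.enc s (fun i : P.M s => x i) = c.enc s (fun i : P.M s => y i))
    (hk : ∀ i ∈ P.K r, x i = y i) {i : X} (hi : i ∈ P.W r) : x i = y i := by
  have hx := c.correct x r
  rw [funext he, funext fun i : P.K r => hk i i.2, c.correct y r] at hx
  exact (congrFun hx ⟨i, hi⟩).symm

section Uniprior

variable {S V : Type*} {P : IndexCodingProblem S V V}

theorem mem_messages_of_adj {i j : V} (h : P.infoFlow.Adj i j) : ∃ s, i ∈ P.M s :=
  Set.mem_iUnion.1 (P.W_subset j h)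

theorem IsUnipriorMulticast.not_adj_self (hP : P.IsUnipriorMulticast) (i : V) :
    ¬ P.infoFlow.Adj i i := fun h =>
  Set.disjoint_left.1 (P.disjoint i) h (by rw [hP i]; exact ⟨rfl, P.W_subset i h⟩)

theorem mem_of_reachable (hM : ∀ s t, s ≠ t → Disjoint (P.M s) (P.M t)) {i j : V}
    (h : P.messageGraph.Reachable i j) {s : S} (hi : i ∈ P.M s) : j ∈ P.M s := by
  obtain ⟨w⟩ := h
  induction w with
  | nil => exact hi
  | cons hadj _ ih =>
    obtain ⟨-, t, hit, hjt⟩ := hadj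
    obtain rfl : t = s := by
      by_contra hne
      exact Set.disjoint_left.1 (hM t s hne) hit hi
    exact ih hjt

theorem messageConnected_of_subset {C : Set V} {s : S} (h : C ⊆ P.M s) :
    MessageConnected P.messageGraph C := by
  intro i j
  by_cases hij : i = j
  · rw [hij]
  · exact SimpleGraph.Adj.reachable
      (show P.messageGraph.Adj i j from ⟨fun e => hij (Subtype.ext e), s, h i.2, h j.2⟩)

theorem subset_of_messageConnected (hM : ∀ s t, s ≠ t → Disjoint (P.M s) (P.M t)) {C : Set V}
    (hC : MessageConnected P.messageGraph C) {i : V} (hi : i ∈ C) {s : S} (his : i ∈ P.M s) :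
    C ⊆ P.M s := fun j hj =>
  mem_of_reachable hM ((hC ⟨i, hi⟩ ⟨j, hj⟩).map (SimpleGraph.Embedding.induce C).toHom) his

/-- Each sender set is a clique that no path of the message graph leaves, so a leaf SCC either lies
in one clique or contains two mutually unreachable vertices. -/
theorem not_isSemiLeafSCC (hM : ∀ s t, s ≠ t → Disjoint (P.M s) (P.M t)) (C : Set V) :
    ¬ IsSemiLeafSCC P.infoFlow P.messageGraph C := by
  rintro ⟨hC, hcon, hdis⟩
  obtain ⟨i, hi⟩ := hC.nontrivial.nonempty
  obtain ⟨_, hadj⟩ := hC.exists_adj hi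
  obtain ⟨s, hs⟩ := mem_messages_of_adj hadj
  refine hcon (messageConnected_of_subset (s := s) fun j hj => ?_)
  by_contra hjs
  exact hdis ⟨i, hi, j, hj, fun h => hjs (mem_of_reachable hM h hs)⟩

/-! ### Lower bound -/

/-- A bit that is required by a receiver whose own bit is not known to the sender of the required
bit is determined by the codewords alone. -/
theorem Code.eq_of_adj_of_notMem (hP : P.IsUnipriorMulticast)
    (hM : ∀ s t, s ≠ t → Disjoint (P.M s) (P.M t)) (c : P.Code) {x y : V → Bool}
    (he : ∀ s, c.enc s (fun i : P.M s => x i) = c.enc s (fun i : P.M s => y i))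
    {i j : V} (hij : P.infoFlow.Adj i j) {t : S} (hi : i ∈ P.M t) (hj : j ∉ P.M t) :
    x i = y i := by
  classical
  -- Zeroing all bits outside `P.M t` keeps the codeword of `t`, makes the other codewords constant,
  -- and makes the bit of receiver `j` agree in both inputs.
  have key : (fun k => if k ∈ P.M t then x k else false) i =
      (fun k => if k ∈ P.M t then y k else false) i := by
    refine c.determined (x := fun k => if k ∈ P.M t then x k else false)
      (y := fun k => if k ∈ P.M t then y k else false) (r := j) (fun s => ?_) (fun k hk => ?_) hij
    · by_cases hst : s = t
      · subst hst
        simpa using he s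
      · congr 1
        funext k
        simp [Set.disjoint_left.1 (hM s t hst) k.2]
    · rw [hP j] at hk
      obtain rfl : k = j := hk.1
      simp [hj]
  simpa [hi] using key

/-- The codewords, the bits at the sinks and one bit of every message-connected leaf SCC determine
all bits. -/
theorem Code.eq_of_roots [Finite V] (hP : P.IsUnipriorMulticast)
    (hM : ∀ s t, s ≠ t → Disjoint (P.M s) (P.M t)) (c : P.Code) {x y : V → Bool}
    (he : ∀ s, c.enc s (fun i : P.M s => x i) = c.enc s (fun i : P.M s => y i))
    (hsink : ∀ i, (∀ j, ¬ P.infoFlow.Adj i j) → x i = y i)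
    (hroot : ∀ C, IsLeafSCC P.infoFlow C → MessageConnected P.messageGraph C →
      ∃ k ∈ C, x k = y k) : x = y := by
  have step : ∀ {i j}, P.infoFlow.Adj i j → x j = y j → x i = y i := by
    intro i j hij hj
    refine c.determined (r := j) he (fun k hk => ?_) hij
    rw [hP j] at hk
    obtain rfl : k = j := hk.1
    exact hj
  have steps : ∀ {i j}, Relation.ReflTransGen P.infoFlow.Adj i j → x j = y j → x i = y i := by
    intro i j hij hj
    induction hij using Relation.ReflTransGen.head_induction_on with
    | refl => exact hj
    | head h _ ih => exact step h ih
  funext i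
  obtain ⟨k, hik, hk | ⟨C, hC, hkC⟩⟩ :=
    P.infoFlow.exists_reach_sink_or_leafSCC hP.not_adj_self i
  · exact steps hik (hsink k hk)
  refine steps hik ?_
  obtain ⟨a, ha, hxa⟩ : ∃ a ∈ C, x a = y a := by
    by_cases hcon : MessageConnected P.messageGraph C
    · exact hroot C hC hcon
    obtain ⟨_, hadj⟩ := hC.exists_adj hkC
    obtain ⟨s, hs⟩ := mem_messages_of_adj hadj
    obtain ⟨j, hj, hjs⟩ := Set.not_subset.1 fun h => hcon (messageConnected_of_subset (s := s) h)
    obtain ⟨a, ha, b, hb, hab, has, hbs⟩ := hC.maximal.1.exists_crossing hkC hs hj hjs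
    obtain ⟨t, hat⟩ := mem_messages_of_adj hab
    have hne : s ≠ t := fun e => has (e ▸ hat)
    exact ⟨a, ha, c.eq_of_adj_of_notMem hP hM he hab hat (Set.disjoint_left.1 (hM s t hne) hbs)⟩
  exact steps (Relation.ReflTransGen.mono (fun _ _ h => h.2.2) _ _ (hC.maximal.1 k hkC a ha)) hxa

/-- Inputs vanishing at the sinks inject into pairs of codewords and root bits; compare the
exponents of 2. -/
theorem Vout_le_length_add [Fintype S] [Finite V] (hP : P.IsUnipriorMulticast)
    (hM : ∀ s t, s ≠ t → Disjoint (P.M s) (P.M t)) (c : P.Code) :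
    Vout P.infoFlow ≤
      c.length + numMessageConnectedLeafSCC P.infoFlow P.messageGraph := by
  classical
  let N : Set V := {i | ∃ j, P.infoFlow.Adj i j}
  let L : Set (Set V) := {C | IsLeafSCC P.infoFlow C ∧ MessageConnected P.messageGraph C}
  have : Fintype N := Fintype.ofFinite N
  have : Fintype L := Fintype.ofFinite L
  have hne : ∀ C : L, ∃ k, k ∈ C.1 := fun C => C.2.1.nontrivial.nonempty
  choose root hroot using hne
  let ext : (N → Bool) → V → Bool := fun x i => if h : i ∈ N then x ⟨i, h⟩ else false
  let f : (N → Bool) → ((Σ s, Fin (c.len s)) ⊕ L → Bool) := fun x =>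
    Sum.elim (fun p => c.enc p.1 (fun i : P.M p.1 => ext x i) p.2) (fun C => ext x (root C))
  have hf : Function.Injective f := by
    intro x y hxy
    have hext : ext x = ext y := by
      refine c.eq_of_roots hP hM (fun s => funext fun k => congrFun hxy (.inl ⟨s, k⟩))
        (fun i hi => ?_) (fun C hC hcon => ⟨root ⟨C, hC, hcon⟩, hroot ⟨C, hC, hcon⟩,
          congrFun hxy (.inr ⟨C, hC, hcon⟩)⟩)
      have hiN : i ∉ N := fun ⟨j, hj⟩ => hi j hj
      simp [ext, hiN]
    funext i
    simpa [ext] using congrFun hext i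
  have hcard := Fintype.card_le_of_injective f hf
  simp only [Fintype.card_pi, Fintype.card_bool, Finset.prod_const, Finset.card_univ,
    Fintype.card_sum, Fintype.card_sigma, Fintype.card_fin] at hcard
  have hle := (Nat.pow_le_pow_iff_right (by norm_num)).1 hcard
  have hN : Fintype.card N = Vout P.infoFlow := by
    rw [← Nat.card_eq_fintype_card]; rfl
  have hL : Fintype.card L = numMessageConnectedLeafSCC P.infoFlow P.messageGraph := by
    rw [← Nat.card_eq_fintype_card]; rfl
  rw [hN, hL] at hle
  exact hle

/-! ### Upper bound -/

/-- Transmitting every required message, in a message-connected leaf SCC as the sum with a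
fixed other message of the component, is an index code. -/
theorem exists_code_length_add [Fintype S] [Finite V] (hP : P.IsUnipriorMulticast)
    (hM : ∀ s t, s ≠ t → Disjoint (P.M s) (P.M t)) :
    ∃ c : P.Code, c.length + numMessageConnectedLeafSCC P.infoFlow P.messageGraph =
      Vout P.infoFlow := by
  classical
  have : Fintype V := Fintype.ofFinite V
  let N : Set V := {i | ∃ j, P.infoFlow.Adj i j}
  let L : Set (Set V) := {C | IsLeafSCC P.infoFlow C ∧ MessageConnected P.messageGraph C}
  have hne : ∀ C : L, ∃ k, k ∈ C.1 := fun C => C.2.1.nontrivial.nonempty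
  choose root hroot using hne
  have hinj : Function.Injective root := by
    intro C D h
    exact Subtype.ext (C.2.1.eq_of_mem D.2.1 (hroot C) (h ▸ hroot D))
  let rt : V → (V → Bool) → Bool := fun i x => if h : ∃ C : L, i ∈ C.1 then x (root h.choose)
    else false
  have rt_eq : ∀ (C : L) {i} (x : V → Bool), i ∈ C.1 → rt i x = x (root C) := by
    intro C i x hi
    have h : ∃ C : L, i ∈ C.1 := ⟨C, hi⟩
    have hC : h.choose = C := Subtype.ext (h.choose.2.1.eq_of_mem C.2.1 h.choose_spec hi)
    simp only [rt, dif_pos h, hC]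
  let T : S → Finset V := fun s => {i | i ∈ P.M s ∧ i ∈ N ∧ i ∉ Set.range root}
  let ext : (s : S) → (P.M s → Bool) → V → Bool :=
    fun s x i => if h : i ∈ P.M s then x ⟨i, h⟩ else false
  let enc : (s : S) → (P.M s → Bool) → (Fin (T s).card → Bool) := fun s x k =>
    xor (x ⟨(T s).equivFin.symm k, by
      have := ((T s).equivFin.symm k).2
      simp only [T, Finset.mem_filter] at this
      exact this.2.1⟩) (rt ((T s).equivFin.symm k) (ext s x))
  have rt_ext : ∀ s (x : V → Bool) {i}, i ∈ P.M s → rt i (ext s fun i => x i) = rt i x := by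
    intro s x i hi
    by_cases h : ∃ C : L, i ∈ C.1
    · obtain ⟨C, hC⟩ := h
      have : root C ∈ P.M s := subset_of_messageConnected hM C.2.2 hC hi (hroot C)
      rw [rt_eq C _ hC, rt_eq C _ hC]
      simp [ext, this]
    · simp only [rt, dif_neg h]
  obtain ⟨c, hc⟩ := P.exists_code_of_determined (fun s => (T s).card) enc (by
    intro x y r he hk i hi
    have hN : i ∈ N := ⟨r, hi⟩
    obtain ⟨s, hs⟩ := mem_messages_of_adj (P := P) hi
    -- This also covers roots, which are not transmitted: their sum with themselves is `false`.
    have hsent : ∀ j ∈ P.M s, j ∈ N → xor (x j) (rt j x) = xor (y j) (rt j y) := by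
      intro j hjs hjN
      by_cases hj : j ∈ Set.range root
      · obtain ⟨C, rfl⟩ := hj
        rw [rt_eq C _ (hroot C), rt_eq C _ (hroot C)]
        simp
      · have hjT : j ∈ T s := by
          simp only [T, Finset.mem_filter]
          exact ⟨Finset.mem_univ _, hjs, hjN, hj⟩
        have := congrFun (he s) ((T s).equivFin ⟨j, hjT⟩)
        simpa only [enc, Equiv.symm_apply_apply, rt_ext s _ hjs] using this
    have hi' := hsent i hs hN
    by_cases h : ∃ C : L, i ∈ C.1
    · obtain ⟨C, hiC⟩ := h
      -- No arc leaves `C`, so receiver `r` lies in it and recovers the root bit from its own bit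
      -- and its own sum.
      have hrC : r ∈ C.1 := C.2.1.no_outgoing i hiC r hi
      have hrs : r ∈ P.M s := subset_of_messageConnected hM C.2.2 hiC hs hrC
      have hr := hsent r hrs (C.2.1.exists_adj hrC)
      have hxr : x r = y r := hk r (by rw [hP r]; exact ⟨rfl, Set.mem_iUnion.2 ⟨s, hrs⟩⟩)
      rw [rt_eq C _ hrC, rt_eq C _ hrC, hxr, Bool.xor_right_inj] at hr
      rwa [rt_eq C _ hiC, rt_eq C _ hiC, hr, Bool.xor_left_inj] at hi'
    · simpa only [rt, dif_neg h, Bool.xor_false] using hi')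
  refine ⟨c, ?_⟩
  have hsum : c.length = (N \ Set.range root).ncard := by
    rw [Code.length, hc, ← Finset.card_biUnion, ← Set.ncard_coe_finset]
    · congr 1
      ext i
      simp only [T, Finset.coe_biUnion, Finset.coe_univ, Set.mem_univ, Set.iUnion_true,
        Set.mem_iUnion, Finset.mem_coe, Finset.mem_filter, Finset.mem_univ, true_and, Set.mem_sdiff]
      refine ⟨fun ⟨_, h⟩ => h.2, fun h => ?_⟩
      obtain ⟨_, hj⟩ := h.1
      obtain ⟨s, hs⟩ := mem_messages_of_adj hj
      exact ⟨s, hs, h⟩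
    · intro s _ t _ hst
      rw [Function.onFun, Finset.disjoint_left]
      intro i hi hi'
      simp only [T, Finset.mem_filter] at hi hi'
      exact Set.disjoint_left.1 (hM s t hst) hi.2.1 hi'.2.1
  have hrange : (Set.range root).ncard = numMessageConnectedLeafSCC P.infoFlow P.messageGraph := by
    rw [← Set.image_univ, Set.ncard_image_of_injective _ hinj, Set.ncard_univ]
    rfl
  rw [hsum, ← hrange]
  refine Set.ncard_sdiff_add_ncard_of_subset ?_ (Set.toFinite _)
  rintro _ ⟨C, rfl⟩
  exact C.2.1.exists_adj (hroot C)

theorem exists_isOptimalLength [Fintype S] [Finite V] (hP : P.IsUnipriorMulticast)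
    (hM : ∀ s t, s ≠ t → Disjoint (P.M s) (P.M t)) :
    ∃ ℓ : ℕ, P.IsOptimalLength ℓ ∧
      (ℓ : ℤ) = Vout P.infoFlow - numMessageConnectedLeafSCC P.infoFlow P.messageGraph := by
  obtain ⟨c, hc⟩ := exists_code_length_add hP hM
  refine ⟨c.length, ⟨⟨c, rfl⟩, ?_⟩, by omega⟩
  rintro _ ⟨d, rfl⟩
  have := Vout_le_length_add hP hM d
  omega

end Uniprior

end IndexCodingProblem

/-- The first conjunct is the result for disjoint sender sets; the second one is the single-sender
case, in which every leaf SCC is message-connected and is counted. -/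
theorem corollary2 {S V : Type*} [Fintype S] [Finite V] (P : IndexCodingProblem S V V)
    (hP : P.IsUnipriorMulticast) :
    ((∀ s t, s ≠ t → Disjoint (P.M s) (P.M t)) →
      (¬ ∃ C, IsSemiLeafSCC P.infoFlow P.messageGraph C) ∧
      ∃ ℓ : ℕ, P.IsOptimalLength ℓ ∧
        (ℓ : ℤ) = Vout P.infoFlow - numMessageConnectedLeafSCC P.infoFlow P.messageGraph) ∧
    (Fintype.card S = 1 →
      (∀ C, IsLeafSCC P.infoFlow C → MessageConnected P.messageGraph C) ∧
      ∃ ℓ : ℕ, P.IsOptimalLength ℓ ∧ (ℓ : ℤ) = Vout P.infoFlow - numLeafSCC P.infoFlow) := by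
  refine ⟨fun hM => ⟨fun ⟨C, hC⟩ => IndexCodingProblem.not_isSemiLeafSCC hM C hC,
    IndexCodingProblem.exists_isOptimalLength hP hM⟩, fun hS => ?_⟩
  obtain ⟨s, hs⟩ := Fintype.card_eq_one_iff.1 hS
  have hM : ∀ s t, s ≠ t → Disjoint (P.M s) (P.M t) :=
    fun a b hab => absurd ((hs a).trans (hs b).symm) hab
  have hcon : ∀ C, IsLeafSCC P.infoFlow C → MessageConnected P.messageGraph C := by
    refine fun C hC => IndexCodingProblem.messageConnected_of_subset (s := s) fun i hi => ?_
    obtain ⟨_, hadj⟩ := hC.exists_adj hi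
    obtain ⟨t, ht⟩ := IndexCodingProblem.mem_messages_of_adj hadj
    exact hs t ▸ ht
  refine ⟨hcon, ?_⟩
  have hnum : numLeafSCC P.infoFlow =
      numMessageConnectedLeafSCC P.infoFlow P.messageGraph := by
    unfold numLeafSCC numMessageConnectedLeafSCC
    congr 1
    ext C
    exact ⟨fun h => ⟨h, hcon C h⟩, fun h => h.1⟩
  rw [hnum]
  exact IndexCodingProblem.exists_isOptimalLength hP hM
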